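/- Let $S$ be a finite nonempty set and let $p : 2^S \to \mathbb{Z} \cup \{-\infty\}$ be a supermodular set function with $p(\emptyset)=0$ and $p(S)$ finite, i.e. $p(X)+p(Y)\le p(X\cap Y)+p(X\cup Y)$ whenever $p(X),p(Y)>-\infty$. Let $$B=\{x\in\mathbb{R}^S : \textstyle\sum_{s\in S}x(s)=p(S),\ \sum_{s\in Z}x(s)\ge p(Z)\ \text{for all } Z\subseteq S\}$$ be the integral base-polyhedron described by $p$, and let $\overset{\ldotp}{B}=B\cap\mathbb{Z}^S$. For $\pi\in\mathbb{Z}^S$ let $$\hat p(\pi)=p(I_n)\pi(s_n)+\sum_{j=1}^{n-1}p(I_j)\,[\pi(s_j)-\pi(s_{j+1})]$$ (with $0\cdot(-\infty)=0$) be the linear (Lovász) extension, where $S=\{s_1,\dots,s_n\}$ is indexed so that $\pi(s_1)\ge\cdots\ge\pi(s_n)$ and $I_j=\{s_1,\dots,s_j\}$. An integral vector $\hat\pi$ is called dual optimal if it attains the maximum on the right-hand side of the square-sum min-max formula $$\min\Big\{\sum_{s\in S}m(s)^2 : m\in\overset{\ldotp}{B}\Big\}=\max\Big\{\hat p(\pi)-\sum_{s\in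 S}\Big\lfloor\frac{\pi(s)}2\Big\rfloor\Big\lceil\frac{\pi(s)}2\Big\rceil : \pi\in\mathbb{Z}^S\Big\}.$$ An element $m\in\overset{\ldotp}{B}$ is dec-min if, for every $y\in\overset{\ldotp}{B}$, the vector of components of $m$ in decreasing order is lexicographically smaller than or equal to that of $y$; let $\mathrm{dm}(\overset{\ldotp}{B})$ be the set of dec-min elements. Then for every dual optimal $\hat\pi$ we have $\mathrm{dm}(\overset{\ldotp}{B})=T(\hat\pi)\cap \overset{\ldotp}{B}{}^{\circ}(\hat\pi)$, where $$T(\hat\pi)=\{m\in\mathbb{Z}^S : m(s)\in\{\lfloor\hat\pi(s)/2\rfloor,\lceil\hat\pi(s)/2\rceil\}\ \text{for all } s\in S\},$$ $$\overset{\ldotp}{B}{}^{\circ}(\hat\pi)=\Big\{m\in\overset{\ldotp}{B} : \sum_{s\in S}\hat\pi(s)m(s)\le\sum_{s\in S}\hat\pi(s)z(s)\ \text{for all } z\in\overset{\ldotp}{B}\Big\}.$$ Moreover, $\mathrm{dm}(\overset{\ldotp}{B})$ is a matroidal M-convex set, that is, there are a matroid on $S$ with rank function $r$ and a vector $\Delta\in\mathbb{Z}^S$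 such that $\mathrm{dm}(\overset{\ldotp}{B})$ is the set of integral members of $\Delta+\{x\in\mathbb{R}^S : \sum_{s\in S}x(s)=r(S),\ \sum_{s\in Z}x(s)\le r(Z)\ \text{for all } Z\subseteq S\}$. -/

import Mathlib

namespace DecMin

variable {S : Type*} [Fintype S]

/-! ### Rearranging the components of an integral vector in decreasing order -/

/-- An indexing `s_0, …, s_{n-1}` of the elements of `S` (with `n = |S|`) such that
`x s_0 ≥ x s_1 ≥ ⋯ ≥ x s_{n-1}`. -/
noncomputable def descEnum (x : S → ℤ) : Fin (Fintype.card S) ≃ S :=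
  (Tuple.sort (fun i => OrderDual.toDual (x ((Fintype.equivFin S).symm i)))).trans
    (Fintype.equivFin S).symm

theorem antitone_descEnum (x : S → ℤ) : Antitone (fun i => x (descEnum x i)) :=
  fun _ _ hij =>
    Tuple.monotone_sort (fun i => OrderDual.toDual (x ((Fintype.equivFin S).symm i))) hij

/-- The vector `x↓`: the components of `x` in decreasing order. -/
noncomputable def sortDesc (x : S → ℤ) : Fin (Fintype.card S) → ℤ :=
  fun i => x (descEnum x i)

/-- `x` and `y` are value-equivalent. -/
def ValueEquivalent (x y : S → ℤ) : Prop :=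
  sortDesc x = sortDesc y

/-- `x` is decreasingly smaller than `y`: at the first position where `x↓` and `y↓` differ,
`x↓` is smaller. -/
def DecSmaller (x y : S → ℤ) : Prop :=
  ∃ j, (∀ i < j, sortDesc x i = sortDesc y i) ∧ sortDesc x j < sortDesc y j

/-- The set of decreasingly minimal elements of a set `Q` of integral vectors. -/
def decMinElements (Q : Set (S → ℤ)) : Set (S → ℤ) :=
  {x | x ∈ Q ∧ ∀ y ∈ Q, DecSmaller x y ∨ ValueEquivalent x y}

/-! ### Base-polyhedra and their integral members -/

/-- The set of integral members of a set `B` of real vectors. -/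
def integralMembers (B : Set (S → ℝ)) : Set (S → ℤ) :=
  {m | (fun s => (m s : ℝ)) ∈ B}

/-- `p` is (fully) supermodular, where the value `⊥` stands for `-∞`. Since `⊥` is absorbing for
addition, the inequality is a condition only on those pairs `X`, `Y` at which `p` is finite. -/
def Supermodular [DecidableEq S] (p : Finset S → WithBot ℤ) : Prop :=
  ∀ X Y : Finset S, p X + p Y ≤ p (X ∩ Y) + p (X ∪ Y)

/-- The base-polyhedron `{x ∈ ℝ^S : x(S) = p(S), x(Z) ≥ p(Z) for every Z ⊆ S}`. -/
def basePolyhedron (p : Finset S → WithBot ℤ) : Set (S → ℝ) :=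
  {x | (p Finset.univ).map (Int.cast : ℤ → ℝ) = ((∑ s, x s : ℝ) : WithBot ℝ) ∧
    ∀ Z : Finset S, (p Z).map (Int.cast : ℤ → ℝ) ≤ ((∑ s ∈ Z, x s : ℝ) : WithBot ℝ)}

/-! ### The linear extension and the dual problem -/

/-- The set of the first `j` elements of `S` in the indexing `e`. -/
def firstElements (e : Fin (Fintype.card S) ≃ S) (j : ℕ) : Finset S :=
  Finset.univ.filter (fun s => (e.symm s : ℕ) < j)

/-- The expression `p(I_n) π(s_n) + ∑_{j=1}^{n-1} p(I_j) (π(s_j) - π(s_{j+1}))` for an indexing `e`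
of the elements of `S`; the product `0 * ⊥` is `0` in `WithBot ℤ`. -/
def linearExtensionAlong [Nonempty S] (p : Finset S → WithBot ℤ) (π : S → ℤ)
    (e : Fin (Fintype.card S) ≃ S) : WithBot ℤ :=
  p (firstElements e (Fintype.card S)) *
      ((π (e ⟨Fintype.card S - 1, Nat.sub_lt Fintype.card_pos Nat.one_pos⟩) : ℤ) : WithBot ℤ) +
    ∑ j : Fin (Fintype.card S - 1),
      p (firstElements e (j + 1)) *
        ((π (e ⟨j, by omega⟩) - π (e ⟨j + 1, by omega⟩) : ℤ) : WithBot ℤ)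

/-- The linear extension (Lovász extension) of `p`, on integral vectors. -/
noncomputable def linearExtension [Nonempty S] (p : Finset S → WithBot ℤ) (π : S → ℤ) :
    WithBot ℤ :=
  linearExtensionAlong p π (descEnum π)

/-- The linear extension may be computed with any indexing along which `π` is decreasing. -/
theorem linearExtension_eq_along [Nonempty S] (p : Finset S → WithBot ℤ) (π : S → ℤ)
    (e : Fin (Fintype.card S) ≃ S) (he : Antitone (fun i => π (e i))) :
    linearExtension p π = linearExtensionAlong p π e := by
  set d := descEnum π with hd
  have hdm : Antitone (fun i => π (d i)) := antitone_descEnum π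
  have key : (fun i => π (d i)) = (fun i => π (e i)) := by
    have h1 := Tuple.unique_monotone
      (f := fun i => OrderDual.toDual (π (d i))) (σ := Equiv.refl _) (τ := e.trans d.symm)
      (fun _ _ h => hdm h) (fun a b h => by simpa using he h)
    funext i
    have h2 := congrFun h1 i
    simpa using h2
  have val : ∀ i, π (d i) = π (e i) := fun i => congrFun key i
  have first_eq : ∀ (c : Fin (Fintype.card S) ≃ S), Antitone (fun i => π (c i)) →
      ∀ (j : ℕ) (h0 : j < Fintype.card S) (h1 : j + 1 < Fintype.card S),
      π (c ⟨j, h0⟩) ≠ π (c ⟨j + 1, h1⟩) →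
      firstElements c (j + 1) = Finset.univ.filter (fun s => π (c ⟨j, h0⟩) ≤ π s) := by
    intro c hc j h0 h1 hne
    ext s
    simp only [firstElements, Finset.mem_filter, Finset.mem_univ, true_and]
    constructor
    · intro h
      have := hc (show c.symm s ≤ ⟨j, h0⟩ from Nat.lt_succ_iff.mp h)
      simpa using this
    · intro h
      by_contra hcon
      have h2 := hc (show (⟨j + 1, h1⟩ : Fin _) ≤ c.symm s from not_lt.mp hcon)
      have h3 := hc (show (⟨j, h0⟩ : Fin _) ≤ ⟨j + 1, h1⟩ from Nat.le_succ j)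
      simp only [Equiv.apply_symm_apply] at h2 h3
      exact hne (le_antisymm (h.trans h2) h3)
  have hall : ∀ c : Fin (Fintype.card S) ≃ S,
      firstElements c (Fintype.card S) = Finset.univ := by
    intro c
    ext s
    simp [firstElements]
  unfold linearExtension linearExtensionAlong
  rw [← hd, hall d, hall e, val]
  congr 1
  refine Finset.sum_congr rfl fun j _ => ?_
  rw [val, val]
  by_cases hj : π (e ⟨j, by omega⟩) = π (e ⟨j + 1, by omega⟩)
  · simp [hj]
  · rw [first_eq e he j (by omega) (by omega) hj,
      first_eq d hdm j (by omega) (by omega) (by rw [val, val]; exact hj), val]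

/-- The dual objective `p̂(π) - ∑_{s ∈ S} ⌊π(s)/2⌋ ⌈π(s)/2⌉`. -/
noncomputable def dualObjective [Nonempty S] (p : Finset S → WithBot ℤ) (π : S → ℤ) : WithBot ℤ :=
  linearExtension p π + ((-∑ s, ⌊(π s : ℝ) / 2⌋ * ⌈(π s : ℝ) / 2⌉ : ℤ) : WithBot ℤ)

/-- `π` is a dual optimal solution: it maximizes the dual objective over `ℤ^S`. -/
def IsDualOptimal [Nonempty S] (p : Finset S → WithBot ℤ) (π : S → ℤ) : Prop :=
  ∀ τ : S → ℤ, dualObjective p τ ≤ dualObjective p π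

/-! ### The two sets in the representation -/

/-- The integral vectors `m` with `m(s) ∈ {⌊π(s)/2⌋, ⌈π(s)/2⌉}` for all `s`. -/
def halfBox (π : S → ℤ) : Set (S → ℤ) :=
  {m | ∀ s, m s = ⌊(π s : ℝ) / 2⌋ ∨ m s = ⌈(π s : ℝ) / 2⌉}

/-- The minimum `π`-weight elements of `Q`. -/
def minWeightElements (Q : Set (S → ℤ)) (π : S → ℤ) : Set (S → ℤ) :=
  {m | m ∈ Q ∧ ∀ z ∈ Q, ∑ s, π s * m s ≤ ∑ s, π s * z s}

/-! ### Matroidal M-convex sets -/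

/-- The base-polyhedron `{x : x(S) = r(S), x(Z) ≤ r(Z) for every Z ⊆ S}` of a matroid `M` on `S`
with rank function `r`. -/
def matroidBasePolyhedron (M : Matroid S) : Set (S → ℝ) :=
  {x | ∑ s, x s = ((M.eRk Set.univ).toNat : ℝ) ∧
    ∀ Z : Finset S, ∑ s ∈ Z, x s ≤ ((M.eRk (Z : Set S)).toNat : ℝ)}

/-- A matroidal M-convex set: the set of integral members of a matroid base-polyhedron
translated by an integral vector. -/
def IsMatroidalMConvex (D : Set (S → ℤ)) : Prop :=
  ∃ (M : Matroid S) (Δ : S → ℤ), M.E = Set.univ ∧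
    D = integralMembers ((fun x s => x s + (Δ s : ℝ)) '' matroidBasePolyhedron M)

end DecMin

/-!
Call a set `Z` tight for an integral base `m` if `m(Z) = p(Z)`; tight sets are closed under
intersection and union. If `m` admits no tightening step `m + χ_s - χ_t` with `m s + 2 ≤ m t`, then
the union of the smallest tight sets around the elements of `{m > β}` lies in `{m ≥ β}`, and these
unions form a chain of tight sets. The chain certifies everything at once: it bounds the excess
`∑ (y - β)⁺` of every base `y` from below by that of `m`, whence `m` is dec-min, and the
half-integral position of each `m s ± 1/2` relative to it gives a dual vector `π` closing the
duality gap for the square-sum. Hence dec-min bases, square-sum minimizers, and bases without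
tightening steps coincide, and complementary slackness for a dual optimal `π` is the stated
representation. For the matroid, integral bases satisfy the simultaneous exchange axiom, convexity
of the square transfers it to the square-sum minimizers, and these lie in the unit box
`[⌊π/2⌋, ⌈π/2⌉]`.
-/

namespace DecMin

section TightSets

variable {S : Type*} {p : Finset S → WithBot ℤ} {m x y : S → ℤ}

/-- The integral vector `m` lies in the supermodular polyhedron of `p`, which is the base-polyhedron
without the equation `m(S) = p(S)`. -/
def Dominates (p : Finset S → WithBot ℤ) (m : S → ℤ) : Prop :=
  ∀ Z : Finset S, p Z ≤ ((∑ s ∈ Z, m s : ℤ) : WithBot ℤ)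

/-- `Z` is tight for `m`: its lower bound `p Z` is attained. -/
def Tight (p : Finset S → WithBot ℤ) (m : S → ℤ) (Z : Finset S) : Prop :=
  p Z = ((∑ s ∈ Z, m s : ℤ) : WithBot ℤ)

theorem tight_empty (h0 : p ∅ = 0) : Tight p m ∅ := by
  simpa [Tight] using h0

theorem Tight.sum_le_sum {Z : Finset S} (hZ : Tight p m Z) (hy : Dominates p y) :
    ∑ s ∈ Z, m s ≤ ∑ s ∈ Z, y s :=
  WithBot.coe_le_coe.mp (hZ ▸ hy Z)

theorem Dominates.le_sub_one_of_not_tight (hm : Dominates p m) {Z : Finset S}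
    (hZ : ¬ Tight p m Z) : p Z ≤ ((∑ s ∈ Z, m s - 1 : ℤ) : WithBot ℤ) := by
  have hlt := lt_of_le_of_ne (hm Z) hZ
  cases h : p Z with
  | bot => exact bot_le
  | coe a => exact WithBot.coe_le_coe.mpr (Int.le_sub_one_of_lt (WithBot.coe_lt_coe.mp (h ▸ hlt)))

theorem exists_dominates [Finite S] (h0 : p ∅ ≤ 0) : ∃ x : S → ℤ, Dominates p x := by
  obtain ⟨b, hb⟩ := (Set.finite_range p).bddAbove
  obtain ⟨k, hk⟩ : ∃ k : ℤ, (k : WithBot ℤ) = b ⊔ 0 :=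
    WithBot.ne_bot_iff_exists.mp (ne_bot_of_le_ne_bot WithBot.zero_ne_bot le_sup_right)
  have hk0 : 0 ≤ k := WithBot.coe_le_coe.mp (le_sup_right.trans_eq hk.symm)
  refine ⟨fun _ => k, fun Z => ?_⟩
  rcases Z.eq_empty_or_nonempty with rfl | hZ
  · simpa using h0
  · calc p Z ≤ k := (hb (Set.mem_range_self Z)).trans (le_sup_left.trans_eq hk.symm)
      _ ≤ ((∑ _s ∈ Z, k : ℤ) : WithBot ℤ) := by
        rw [WithBot.coe_le_coe, Finset.sum_const, nsmul_eq_mul]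
        exact le_mul_of_one_le_left hk0 (mod_cast hZ.card_pos)

variable [DecidableEq S]

theorem Tight.inter (hp : Supermodular p) (hm : Dominates p m) {X Y : Finset S}
    (hX : Tight p m X) (hY : Tight p m Y) : Tight p m (X ∩ Y) := by
  by_contra h
  have hXY := (hp X Y).trans (add_le_add (hm.le_sub_one_of_not_tight h) (hm (X ∪ Y)))
  rw [hX, hY, ← WithBot.coe_add, ← WithBot.coe_add, WithBot.coe_le_coe] at hXY
  linarith [Finset.sum_union_inter (s₁ := X) (s₂ := Y) (f := m)]

theorem Tight.union (hp : Supermodular p) (hm : Dominates p m) {X Y : Finset S}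
    (hX : Tight p m X) (hY : Tight p m Y) : Tight p m (X ∪ Y) := by
  by_contra h
  have hXY := (hp X Y).trans (add_le_add (hm (X ∩ Y)) (hm.le_sub_one_of_not_tight h))
  rw [hX, hY, ← WithBot.coe_add, ← WithBot.coe_add, WithBot.coe_le_coe] at hXY
  linarith [Finset.sum_union_inter (s₁ := X) (s₂ := Y) (f := m)]

theorem Tight.sup {ι : Type*} (hp : Supermodular p) (h0 : p ∅ = 0) (hm : Dominates p m)
    {I : Finset ι} {Z : ι → Finset S} (hZ : ∀ i ∈ I, Tight p m (Z i)) : Tight p m (I.sup Z) :=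
  Finset.sup_induction (tight_empty h0) (fun _ hX _ hY => hX.union hp hm hY) hZ

theorem Tight.sum_sdiff_le_sum_sdiff (hp : Supermodular p) (hx : Dominates p x)
    (hy : Dominates p y) {X Y : Finset S} (hX : Tight p x X) (hY : Tight p y Y) :
    ∑ s ∈ X \ Y, x s ≤ ∑ s ∈ X \ Y, y s := by
  have hXY := (hp X Y).trans (add_le_add (hx (X ∩ Y)) (hy (X ∪ Y)))
  rw [hX, hY, ← WithBot.coe_add, ← WithBot.coe_add, WithBot.coe_le_coe,
    ← Finset.sdiff_union_self_eq_union, Finset.sum_union Finset.sdiff_disjoint,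
    ← Finset.sum_inter_add_sum_sdiff X Y x] at hXY
  linarith

end TightSets

section Shift

variable {S : Type*} [DecidableEq S]

/-- The vector `m + χ_s - χ_t`, the result of moving one unit from `t` to `s`. -/
def shift (m : S → ℤ) (s t : S) : S → ℤ :=
  m + Pi.single s 1 - Pi.single t 1

theorem sum_shift (m : S → ℤ) (s t : S) (Z : Finset S) :
    ∑ u ∈ Z, shift m s t u =
      ∑ u ∈ Z, m u + (if s ∈ Z then 1 else 0) - (if t ∈ Z then 1 else 0) := by
  simp only [shift, Pi.sub_apply, Pi.add_apply, Finset.sum_sub_distrib, Finset.sum_add_distrib,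
    Finset.sum_pi_single']

theorem sum_apply_shift [Fintype S] {R : Type*} [AddCommGroup R] (φ : S → ℤ → R) (m : S → ℤ)
    {s t : S} (hst : s ≠ t) :
    ∑ u, φ u (shift m s t u) =
      ∑ u, φ u (m u) + (φ s (m s + 1) - φ s (m s)) + (φ t (m t - 1) - φ t (m t)) := by
  have hterm (u : S) : φ u (shift m s t u) = φ u (m u) +
      (Pi.single s (φ s (m s + 1) - φ s (m s)) : S → R) u +
      (Pi.single t (φ t (m t - 1) - φ t (m t)) : S → R) u := by
    rcases eq_or_ne u s with rfl | hus
    · simp [shift, hst]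
    rcases eq_or_ne u t with rfl | hut
    · simp [shift, hus]
    · simp [shift, hus, hut]
  simp only [hterm, Finset.sum_add_distrib, Finset.sum_pi_single', Finset.mem_univ, if_true]

theorem Dominates.sub_single {p : Finset S → WithBot ℤ} {m : S → ℤ} (hm : Dominates p m) {t : S}
    (h : ∀ Z, Tight p m Z → t ∉ Z) : Dominates p (m - Pi.single t 1) := by
  intro Z
  simp only [Pi.sub_apply, Finset.sum_sub_distrib, Finset.sum_pi_single']
  split_ifs with ht
  · exact hm.le_sub_one_of_not_tight fun hZ => h Z hZ ht
  · simpa using hm Z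

theorem Dominates.shift {p : Finset S → WithBot ℤ} {m : S → ℤ} (hm : Dominates p m) {s t : S}
    (h : ∀ Z, Tight p m Z → t ∈ Z → s ∈ Z) : Dominates p (shift m s t) := by
  intro Z
  rw [sum_shift]
  by_cases hZ : Tight p m Z
  · refine (hm Z).trans (WithBot.coe_le_coe.mpr ?_)
    have := h Z hZ
    split_ifs <;> grind
  · refine (hm.le_sub_one_of_not_tight hZ).trans (WithBot.coe_le_coe.mpr ?_)
    split_ifs <;> lia

end Shift

section IntegralBases

variable {S : Type*} [Fintype S] {p : Finset S → WithBot ℤ} {m : S → ℤ}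

/-- The integral bases of `p`: the integral members of its base-polyhedron. -/
abbrev integralBases (p : Finset S → WithBot ℤ) : Set (S → ℤ) :=
  integralMembers (basePolyhedron p)

theorem mem_integralBases : m ∈ integralBases p ↔ Tight p m Finset.univ ∧ Dominates p m := by
  have hle (a : WithBot ℤ) (k : ℤ) :
      a.map (Int.cast : ℤ → ℝ) ≤ ((k : ℝ) : WithBot ℝ) ↔ a ≤ k :=
    WithBot.map_le_iff (y := (k : WithBot ℤ)) Int.cast Int.cast_le
  have heq (a : WithBot ℤ) (k : ℤ) :
      a.map (Int.cast : ℤ → ℝ) = ((k : ℝ) : WithBot ℝ) ↔ a = k :=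
    (WithBot.map_injective Int.cast_injective).eq_iff (b := (k : WithBot ℤ))
  simp only [integralMembers, basePolyhedron, Set.mem_ofPred_eq, ← Int.cast_sum, hle, heq, Tight,
    Dominates]

theorem dominates_of_mem_integralBases (hm : m ∈ integralBases p) : Dominates p m :=
  (mem_integralBases.mp hm).2

theorem exists_isMinOn_of_bddBelow {α : Type*} {Q : Set α} (hQ : Q.Nonempty) {f : α → ℤ}
    (hf : BddBelow (f '' Q)) : ∃ a ∈ Q, IsMinOn f Q a := by
  obtain ⟨a, ha, hfa⟩ := Int.csInf_mem (hQ.image f) hf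
  exact ⟨a, ha, fun b hb => hfa.trans_le (csInf_le hf (Set.mem_image_of_mem f hb))⟩

theorem exists_isMinOn_sum_sq {Q : Set (S → ℤ)} (hQ : Q.Nonempty) :
    ∃ m ∈ Q, IsMinOn (fun x : S → ℤ => ∑ s, x s ^ 2) Q m :=
  exists_isMinOn_of_bddBelow hQ ⟨0, by rintro _ ⟨x, -, rfl⟩; positivity⟩

variable [DecidableEq S]

theorem integralBases_nonempty (hp : Supermodular p) (h0 : p ∅ = 0)
    (huniv : p Finset.univ ≠ ⊥) : (integralBases p).Nonempty := by
  obtain ⟨c, hc⟩ := WithBot.ne_bot_iff_exists.mp huniv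
  have hbdd : BddBelow ((fun x : S → ℤ => ∑ s, x s) '' {x | Dominates p x}) := by
    refine ⟨c, ?_⟩
    rintro _ ⟨x, hx, rfl⟩
    exact WithBot.coe_le_coe.mp (hc.trans_le (hx Finset.univ))
  obtain ⟨x, hx, hmin⟩ := exists_isMinOn_of_bddBelow (exists_dominates h0.le) hbdd
  have hcover (t : S) : ∃ Z, Tight p x Z ∧ t ∈ Z := by
    by_contra! h
    have := hmin (Dominates.sub_single hx h)
    simp at this
  choose Z hZ htZ using hcover
  have huniv_eq : Finset.univ.sup Z = Finset.univ :=
    Finset.eq_univ_of_forall fun t => Finset.mem_sup.mpr ⟨t, Finset.mem_univ t, htZ t⟩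
  refine ⟨x, mem_integralBases.mpr ⟨?_, hx⟩⟩
  exact huniv_eq ▸ Tight.sup hp h0 hx fun t _ => hZ t

theorem shift_mem_integralBases (hm : m ∈ integralBases p) {s t : S}
    (h : ∀ Z, Tight p m Z → t ∈ Z → s ∈ Z) : shift m s t ∈ integralBases p := by
  rw [mem_integralBases] at hm ⊢
  refine ⟨?_, hm.2.shift h⟩
  simpa [Tight, sum_shift] using hm.1

theorem exists_tight_mem_forall_shift_mem (hp : Supermodular p) (hm : m ∈ integralBases p) (t : S) :
    ∃ H, Tight p m H ∧ t ∈ H ∧ ∀ s ∈ H, shift m s t ∈ integralBases p := by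
  classical
  have hm' := mem_integralBases.mp hm
  refine ⟨(Finset.univ.filter fun Z => Tight p m Z ∧ t ∈ Z).inf id, ?_, ?_, fun s hs => ?_⟩
  · exact Finset.inf_induction hm'.1 (fun _ hX _ hY => hX.inter hp hm'.2 hY)
      fun Z hZ => (Finset.mem_filter.mp hZ).2.1
  · simp [Finset.mem_inf]
  · refine shift_mem_integralBases hm fun Z hZ ht => ?_
    exact Finset.mem_inf.mp hs Z (by simp [hZ, ht])

theorem exists_tight_notMem_forall_shift_mem (hp : Supermodular p) (h0 : p ∅ = 0)
    (hm : m ∈ integralBases p) (t : S) :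
    ∃ K, Tight p m K ∧ t ∉ K ∧ ∀ s ∉ K, shift m t s ∈ integralBases p := by
  classical
  refine ⟨(Finset.univ.filter fun Z => Tight p m Z ∧ t ∉ Z).sup id, ?_, ?_, fun s hs => ?_⟩
  · exact Tight.sup hp h0 (dominates_of_mem_integralBases hm)
      fun Z hZ => (Finset.mem_filter.mp hZ).2.1
  · simp [Finset.mem_sup]
  · refine shift_mem_integralBases hm fun Z hZ hsZ => ?_
    by_contra ht
    exact hs (Finset.mem_sup.mpr ⟨Z, by simp [hZ, ht], hsZ⟩)

end IntegralBases

section Exchange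

variable {S : Type*} [DecidableEq S]

/-- An M-convex set: a set of integral vectors with the simultaneous exchange property (B-EXC) of
discrete convex analysis. The empty set is allowed. -/
def IsMConvex (Q : Set (S → ℤ)) : Prop :=
  ∀ x ∈ Q, ∀ y ∈ Q, ∀ t, y t < x t → ∃ s, x s < y s ∧ shift x s t ∈ Q ∧ shift y t s ∈ Q

variable [Fintype S]

theorem isMConvex_integralBases {p : Finset S → WithBot ℤ} (hp : Supermodular p) (h0 : p ∅ = 0) :
    IsMConvex (integralBases p) := by
  intro x hx y hy t ht
  obtain ⟨H, hH, htH, hxH⟩ := exists_tight_mem_forall_shift_mem hp hx t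
  obtain ⟨K, hK, htK, hyK⟩ := exists_tight_notMem_forall_shift_mem hp h0 hy t
  have hsum : ∑ s ∈ H \ K, x s ≤ ∑ s ∈ H \ K, y s :=
    hH.sum_sdiff_le_sum_sdiff hp (dominates_of_mem_integralBases hx)
      (dominates_of_mem_integralBases hy) hK
  obtain ⟨s, hs, hlt⟩ : ∃ s ∈ H \ K, x s < y s := by
    by_contra! h
    exact hsum.not_gt (Finset.sum_lt_sum h ⟨t, Finset.mem_sdiff.mpr ⟨htH, htK⟩, ht⟩)
  obtain ⟨hsH, hsK⟩ := Finset.mem_sdiff.mp hs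
  exact ⟨s, hlt, hxH s hsH, hyK s hsK⟩

theorem IsMConvex.setOf_isMinOn_sum {Q : Set (S → ℤ)} (hQ : IsMConvex Q) {R : Type*}
    [AddCommGroup R] [LinearOrder R] [IsOrderedAddMonoid R] {φ : S → ℤ → R}
    (hφ : ∀ s, Monotone fun k => φ s (k + 1) - φ s k) :
    IsMConvex {x ∈ Q | IsMinOn (fun x => ∑ s, φ s (x s)) Q x} := by
  rintro x ⟨hx, hxmin⟩ y ⟨hy, hymin⟩ t ht
  obtain ⟨s, hs, hxs, hys⟩ := hQ x hx y hy t ht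
  have hst : s ≠ t := by rintro rfl; exact ht.asymm hs
  have hxle := hxmin hxs
  have hyle := hymin hys
  have hslope_s := hφ s (Int.le_sub_one_of_lt hs)
  have hslope_t := hφ t (Int.le_sub_one_of_lt ht)
  simp only [Set.mem_ofPred_eq, sum_apply_shift φ x hst, sum_apply_shift φ y hst.symm,
    sub_add_cancel] at hxle hyle hslope_s hslope_t
  refine ⟨s, hs, ⟨hxs, fun z hz => ?_⟩, hys, fun z hz => ?_⟩
  · refine le_trans ?_ (hxmin hz)
    simp only [sum_apply_shift φ x hst]
    grind
  · refine le_trans ?_ (hymin hz)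
    simp only [sum_apply_shift φ y hst.symm]
    grind

end Exchange

section DecreasingOrder

variable {S : Type*} [Fintype S] {x y : S → ℤ}

theorem decSmaller_or_valueEquivalent_iff :
    DecSmaller x y ∨ ValueEquivalent x y ↔ toLex (sortDesc x) ≤ toLex (sortDesc y) :=
  (le_iff_lt_or_eq (a := toLex (sortDesc x)) (b := toLex (sortDesc y))).symm

theorem mem_decMinElements {Q : Set (S → ℤ)} :
    x ∈ decMinElements Q ↔ x ∈ Q ∧ ∀ y ∈ Q, toLex (sortDesc x) ≤ toLex (sortDesc y) := by
  simp only [decMinElements, Set.mem_ofPred_eq, decSmaller_or_valueEquivalent_iff]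

theorem sum_sortDesc {R : Type*} [AddCommMonoid R] (f : ℤ → R) (x : S → ℤ) :
    ∑ i, f (sortDesc x i) = ∑ s, f (x s) :=
  Equiv.sum_comp (descEnum x) fun s => f (x s)

/-- The total excess `∑ (x - β)⁺` of `x` over the threshold `β`. -/
def excess (x : S → ℤ) (β : ℤ) : ℤ := ∑ s, max (x s - β) 0

theorem toLex_sortDesc_le_of_excess_le (h : ∀ β, excess x β ≤ excess y β) :
    toLex (sortDesc x) ≤ toLex (sortDesc y) := by
  by_contra! hlt
  obtain ⟨j, heq, hj⟩ : DecSmaller y x := hlt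
  refine (h (sortDesc y j)).not_gt ?_
  rw [excess, excess, ← sum_sortDesc (fun a => max (a - sortDesc y j) 0) x,
    ← sum_sortDesc (fun a => max (a - sortDesc y j) 0) y]
  refine Finset.sum_lt_sum (fun i _ => ?_) ⟨j, Finset.mem_univ j, ?_⟩
  · rcases lt_or_ge i j with hij | hij
    · rw [heq i hij]
    · have hyi : sortDesc y i ≤ sortDesc y j := antitone_descEnum y hij
      exact max_le (by simp [hyi]) (le_max_right _ _)
  · simpa using hj

end DecreasingOrder

section Tightening

variable {S : Type*} {p : Finset S → WithBot ℤ} {m y : S → ℤ}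

/-- A certificate of optimality for `m`: a family of `m`-tight sets, necessarily a chain, the member
at level `β` lying between the level sets `{m > β}` and `{m ≥ β}`. -/
structure IsSeparatingChain (p : Finset S → WithBot ℤ) (m : S → ℤ) (C : ℤ → Finset S) : Prop where
  tight : ∀ β, Tight p m (C β)
  mem_of_lt : ∀ {β s}, β < m s → s ∈ C β
  le_of_mem : ∀ {β s}, s ∈ C β → β ≤ m s

variable [Fintype S]

theorem IsSeparatingChain.excess_le {C : ℤ → Finset S} (hC : IsSeparatingChain p m C)
    (hy : Dominates p y) (β : ℤ) : excess m β ≤ excess y β :=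
  calc excess m β = ∑ s ∈ C β, max (m s - β) 0 :=
        (Finset.sum_subset (Finset.subset_univ _) fun s _ hs =>
          max_eq_right (sub_nonpos.mpr (not_lt.mp (mt hC.mem_of_lt hs)))).symm
    _ = ∑ s ∈ C β, (m s - β) :=
        Finset.sum_congr rfl fun s hs => max_eq_left (sub_nonneg.mpr (hC.le_of_mem hs))
    _ ≤ ∑ s ∈ C β, (y s - β) := by
        simpa only [Finset.sum_sub_distrib, sub_le_sub_iff_right] using
          (hC.tight β).sum_le_sum hy
    _ ≤ ∑ s ∈ C β, max (y s - β) 0 := Finset.sum_le_sum fun s _ => le_max_left _ _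
    _ ≤ excess y β :=
        Finset.sum_le_univ_sum_of_nonneg fun s => le_max_right _ _

theorem IsSeparatingChain.mem_decMinElements {C : ℤ → Finset S} (hC : IsSeparatingChain p m C)
    (hm : m ∈ integralBases p) : m ∈ decMinElements (integralBases p) :=
  DecMin.mem_decMinElements.mpr ⟨hm, fun _ hy =>
    toLex_sortDesc_le_of_excess_le (hC.excess_le (dominates_of_mem_integralBases hy))⟩

variable [DecidableEq S]

/-- The integral base `m` admits no 1-tightening step: no unit can be moved from a component to one
that is smaller by at least two. -/
def NoTightening (p : Finset S → WithBot ℤ) (m : S → ℤ) : Prop :=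
  ∀ s t, m s + 2 ≤ m t → shift m s t ∉ integralBases p

theorem NoTightening.exists_isSeparatingChain (hp : Supermodular p) (h0 : p ∅ = 0)
    (hm : m ∈ integralBases p) (h : NoTightening p m) : ∃ C, IsSeparatingChain p m C := by
  choose H hH htH hshift using exists_tight_mem_forall_shift_mem hp hm
  refine ⟨fun β => (Finset.univ.filter (β < m ·)).sup H, fun β => ?_, fun hlt => ?_, fun hs => ?_⟩
  · exact Tight.sup hp h0 (dominates_of_mem_integralBases hm) fun t _ => hH t
  · exact Finset.mem_sup.mpr ⟨_, by simpa using hlt, htH _⟩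
  · obtain ⟨t, ht, hst⟩ := Finset.mem_sup.mp hs
    by_contra! hlt
    exact h _ t (by grind) (hshift t _ hst)

theorem sum_sq_shift_lt {s t : S} (h : m s + 2 ≤ m t) :
    ∑ u, shift m s t u ^ 2 < ∑ u, m u ^ 2 := by
  have hst : s ≠ t := by rintro rfl; lia
  rw [sum_apply_shift (fun _ k => k ^ 2) m hst]
  linarith

theorem excess_shift_le {s t : S} (h : m s + 2 ≤ m t) (β : ℤ) :
    excess (shift m s t) β ≤ excess m β := by
  have hst : s ≠ t := by rintro rfl; lia
  rw [excess, excess, sum_apply_shift (fun _ k => max (k - β) 0) m hst]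
  grind

theorem noTightening_of_mem_decMinElements (hm : m ∈ decMinElements (integralBases p)) :
    NoTightening p m := by
  intro s t hst hmem
  have hsort : sortDesc (shift m s t) = sortDesc m := toLex_inj.mp <|
    (toLex_sortDesc_le_of_excess_le (excess_shift_le hst)).antisymm
      ((mem_decMinElements.mp hm).2 _ hmem)
  refine (sum_sq_shift_lt hst).ne ?_
  rw [← sum_sortDesc (· ^ 2), hsort, sum_sortDesc (· ^ 2)]

theorem noTightening_of_isMinOn_sum_sq
    (hm : IsMinOn (fun x : S → ℤ => ∑ s, x s ^ 2) (integralBases p) m) : NoTightening p m :=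
  fun _ _ hst hmem => (hm hmem).not_gt (sum_sq_shift_lt hst)

end Tightening

section Halves

theorem sub_floor_mul_sub_ceil_nonneg {R : Type*} [Ring R] [LinearOrder R] [IsStrictOrderedRing R]
    [FloorRing R] (x : R) (k : ℤ) : 0 ≤ (k - ⌊x⌋) * (k - ⌈x⌉) := by
  have hfc := Int.floor_le_ceil x
  have hcf := Int.ceil_le_floor_add_one x
  rcases le_or_gt k ⌊x⌋ with hk | hk
  · exact mul_nonneg_of_nonpos_of_nonpos (by lia) (by lia)
  · exact mul_nonneg (by lia) (by lia)

theorem floor_half_add_ceil_half (a : ℤ) : ⌊(a : ℝ) / 2⌋ + ⌈(a : ℝ) / 2⌉ = a := by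
  have hfloor (b : ℤ) : ⌊(b : ℝ) / 2⌋ = b / 2 := by simpa using Int.floor_div_natCast (b : ℝ) 2
  have hceil : ⌈(a : ℝ) / 2⌉ = -(-a / 2) := by
    rw [← hfloor, Int.cast_neg, neg_div, Int.floor_neg, neg_neg]
  rw [hfloor, hceil]
  lia

theorem sq_sub_mul_sub_floor_half_mul_ceil_half (a k : ℤ) :
    k ^ 2 - (a * k - ⌊(a : ℝ) / 2⌋ * ⌈(a : ℝ) / 2⌉) =
      (k - ⌊(a : ℝ) / 2⌋) * (k - ⌈(a : ℝ) / 2⌉) := by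
  linear_combination k * floor_half_add_ceil_half a

variable {S : Type*}

theorem mem_halfBox_iff {π m : S → ℤ} : m ∈ halfBox π ↔ ∀ s, |2 * m s - π s| ≤ 1 := by
  refine forall_congr' fun s => ?_
  have hadd := floor_half_add_ceil_half (π s)
  have hfc := Int.floor_le_ceil ((π s : ℝ) / 2)
  have hcf := Int.ceil_le_floor_add_one ((π s : ℝ) / 2)
  rw [abs_le]
  lia

theorem halfBox_subset_Icc (π : S → ℤ) :
    halfBox π ⊆ Set.Icc (fun s => ⌊(π s : ℝ) / 2⌋) ((fun s => ⌊(π s : ℝ) / 2⌋) + 1) := by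
  refine fun m hm => ⟨fun s => ?_, fun s => ?_⟩
  · rcases hm s with h | h
    · exact h.ge
    · exact (Int.floor_le_ceil _).trans_eq h.symm
  · rcases hm s with h | h
    · exact h.trans_le (Int.le_add_one le_rfl)
    · exact h.trans_le (Int.ceil_le_floor_add_one _)

variable [Fintype S] (π m : S → ℤ)

theorem sum_mul_sub_le_sum_sq :
    ∑ s, π s * m s - ∑ s, ⌊(π s : ℝ) / 2⌋ * ⌈(π s : ℝ) / 2⌉ ≤ ∑ s, m s ^ 2 := by
  rw [← Finset.sum_sub_distrib]
  refine Finset.sum_le_sum fun s _ => sub_nonneg.mp ?_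
  rw [sq_sub_mul_sub_floor_half_mul_ceil_half]
  exact sub_floor_mul_sub_ceil_nonneg _ _

theorem sum_mul_sub_eq_sum_sq_iff :
    ∑ s, π s * m s - ∑ s, ⌊(π s : ℝ) / 2⌋ * ⌈(π s : ℝ) / 2⌉ = ∑ s, m s ^ 2 ↔ m ∈ halfBox π := by
  rw [eq_comm, ← sub_eq_zero, ← Finset.sum_sub_distrib, ← Finset.sum_sub_distrib]
  simp only [sq_sub_mul_sub_floor_half_mul_ceil_half]
  rw [Finset.sum_eq_zero_iff_of_nonneg fun s _ => sub_floor_mul_sub_ceil_nonneg _ _]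
  simp only [Finset.mem_univ, true_imp_iff, mul_eq_zero, sub_eq_zero, halfBox, Set.mem_ofPred_eq]

end Halves

section LinearExtension

variable {S : Type*} [Fintype S]

theorem firstElements_card (e : Fin (Fintype.card S) ≃ S) :
    firstElements e (Fintype.card S) = Finset.univ := by
  simp [firstElements]

theorem firstElements_succ_eq_filter {π : S → ℤ} {e : Fin (Fintype.card S) ≃ S}
    (he : Antitone fun i => π (e i)) {j : ℕ} (hj : j + 1 < Fintype.card S)
    (hne : π (e ⟨j, by lia⟩) ≠ π (e ⟨j + 1, hj⟩)) :
    firstElements e (j + 1) = Finset.univ.filter fun s => π (e ⟨j, by lia⟩) ≤ π s := by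
  have hlt : π (e ⟨j + 1, hj⟩) < π (e ⟨j, by lia⟩) :=
    hne.symm.lt_of_le (he (Fin.mk_le_mk.mpr j.le_succ))
  ext s
  obtain ⟨i, rfl⟩ := e.surjective s
  simp only [firstElements, Finset.mem_filter_univ, Equiv.symm_apply_apply]
  refine ⟨fun hi => he (Fin.mk_le_mk.mpr (Nat.le_of_lt_succ hi)), fun hi => ?_⟩
  by_contra! hji
  exact hlt.not_ge (hi.trans (he (Fin.mk_le_mk.mpr hji)))

theorem sum_firstElements {e : Fin (Fintype.card S) ≃ S} {f : S → ℤ} {a : ℕ → ℤ}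
    (ha : ∀ i : Fin (Fintype.card S), a i = f (e i)) {j : ℕ} (hj : j ≤ Fintype.card S) :
    ∑ s ∈ firstElements e j, f s = ∑ i ∈ Finset.range j, a i := by
  refine Finset.sum_bij (fun s _ => e.symm s) (fun s hs => ?_) (fun s _ t _ hst => ?_)
    (fun i hi => ?_) fun s _ => ?_
  · simpa [firstElements] using hs
  · exact e.symm.injective (Fin.ext hst)
  · have hi := Finset.mem_range.mp hi
    exact ⟨e ⟨i, hi.trans_le hj⟩, by simpa [firstElements] using hi, by simp⟩
  · rw [ha, e.apply_symm_apply]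

variable [Nonempty S] {p q : Finset S → WithBot ℤ}

theorem linearExtension_mono (huniv : p Finset.univ = q Finset.univ) (h : ∀ Z, p Z ≤ q Z)
    (π : S → ℤ) : linearExtension p π ≤ linearExtension q π := by
  rw [linearExtension, linearExtension, linearExtensionAlong, linearExtensionAlong,
    firstElements_card, huniv]
  gcongr with j
  · exact WithBot.coe_le_coe.mpr
      (sub_nonneg.mpr (antitone_descEnum π (Fin.mk_le_mk.mpr (Nat.le_succ _))))
  · exact h _

theorem linearExtension_congr {π : S → ℤ} (huniv : p Finset.univ = q Finset.univ)
    (h : ∀ s, p (Finset.univ.filter (π s ≤ π ·)) = q (Finset.univ.filter (π s ≤ π ·))) :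
    linearExtension p π = linearExtension q π := by
  rw [linearExtension, linearExtension, linearExtensionAlong, linearExtensionAlong,
    firstElements_card, huniv]
  congr 1
  refine Finset.sum_congr rfl fun j _ => ?_
  by_cases hj : π (descEnum π ⟨j, by lia⟩) = π (descEnum π ⟨j + 1, by lia⟩)
  · rw [hj, sub_self, WithBot.coe_zero, mul_zero, mul_zero]
  · rw [firstElements_succ_eq_filter (antitone_descEnum π) (by lia) hj, h]

theorem sum_mul_eq_sum_firstElements (e : Fin (Fintype.card S) ≃ S) (m π : S → ℤ) :
    ∑ s, π s * m s =
      (∑ s, m s) * π (e ⟨Fintype.card S - 1, Nat.sub_lt Fintype.card_pos Nat.one_pos⟩) +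
        ∑ j : Fin (Fintype.card S - 1), (∑ s ∈ firstElements e (j + 1), m s) *
          (π (e ⟨j, by lia⟩) - π (e ⟨j + 1, by lia⟩)) := by
  obtain ⟨a, ha⟩ := Fin.val_injective.surjective_comp_right (m ∘ e)
  obtain ⟨b, hb⟩ := Fin.val_injective.surjective_comp_right (π ∘ e)
  have ha := congrFun ha
  have hb := congrFun hb
  simp only [Function.comp_apply] at ha hb
  have hab (i : Fin (Fintype.card S)) : b i * a i = π (e i) * m (e i) := by rw [ha, hb]
  have hparts := Finset.sum_range_by_parts b a (Fintype.card S)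
  simp only [smul_eq_mul] at hparts
  rw [← firstElements_card e,
    sum_firstElements (a := fun i => b i * a i) hab le_rfl, hparts, sum_firstElements ha le_rfl,
    ← hb, mul_comm, sub_eq_add_neg, ← Finset.sum_neg_distrib]
  congr 1
  rw [Finset.sum_range]
  refine Finset.sum_congr rfl fun j _ => ?_
  rw [sum_firstElements ha (by lia), ← hb, ← hb]
  ring

theorem linearExtension_sum (m π : S → ℤ) :
    linearExtension (fun Z => ((∑ s ∈ Z, m s : ℤ) : WithBot ℤ)) π =
      ((∑ s, π s * m s : ℤ) : WithBot ℤ) := by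
  rw [linearExtension, linearExtensionAlong, firstElements_card,
    sum_mul_eq_sum_firstElements (descEnum π)]
  simp only [WithBot.coe_add, WithBot.coe_mul, WithBot.coe_sum]

variable {m : S → ℤ}

theorem linearExtension_le (hm : m ∈ integralBases p) (π : S → ℤ) :
    linearExtension p π ≤ ((∑ s, π s * m s : ℤ) : WithBot ℤ) := by
  rw [mem_integralBases] at hm
  exact (linearExtension_mono (q := fun Z => ((∑ s ∈ Z, m s : ℤ) : WithBot ℤ)) hm.1 hm.2 π).trans_eq
    (linearExtension_sum m π)

theorem linearExtension_eq_of_tight {π : S → ℤ} (huniv : Tight p m Finset.univ)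
    (h : ∀ s, Tight p m (Finset.univ.filter (π s ≤ π ·))) :
    linearExtension p π = ((∑ s, π s * m s : ℤ) : WithBot ℤ) :=
  (linearExtension_congr (q := fun Z => ((∑ s ∈ Z, m s : ℤ) : WithBot ℤ)) huniv h).trans
    (linearExtension_sum m π)

end LinearExtension

section Duality

variable {S : Type*} [Fintype S] [Nonempty S] {p : Finset S → WithBot ℤ} {m : S → ℤ}

theorem dualObjective_le (hm : m ∈ integralBases p) (π : S → ℤ) :
    dualObjective p π ≤ ((∑ s, m s ^ 2 : ℤ) : WithBot ℤ) :=
  calc dualObjective p π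
      ≤ ((∑ s, π s * m s + -∑ s, ⌊(π s : ℝ) / 2⌋ * ⌈(π s : ℝ) / 2⌉ : ℤ) : WithBot ℤ) :=
        add_le_add_left (linearExtension_le hm π) _
    _ ≤ ((∑ s, m s ^ 2 : ℤ) : WithBot ℤ) :=
        WithBot.coe_le_coe.mpr (sum_mul_sub_le_sum_sq π m)

theorem sum_sq_le_dualObjective_iff (hm : m ∈ integralBases p) (π : S → ℤ) :
    ((∑ s, m s ^ 2 : ℤ) : WithBot ℤ) ≤ dualObjective p π ↔
      m ∈ halfBox π ∧ linearExtension p π = ((∑ s, π s * m s : ℤ) : WithBot ℤ) := by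
  have hle := linearExtension_le hm π
  have hbox := sum_mul_sub_le_sum_sq π m
  rw [← sum_mul_sub_eq_sum_sq_iff, dualObjective]
  cases h : linearExtension p π with
  | bot =>
    simp only [WithBot.bot_add, le_bot_iff, WithBot.coe_ne_bot, WithBot.bot_ne_coe, and_false]
  | coe a =>
    rw [h, WithBot.coe_le_coe] at hle
    rw [← WithBot.coe_add, WithBot.coe_le_coe, WithBot.coe_inj]
    lia

theorem isMinOn_sum_sq_of_le_dualObjective {π : S → ℤ}
    (hπ : ((∑ s, m s ^ 2 : ℤ) : WithBot ℤ) ≤ dualObjective p π) :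
    IsMinOn (fun x : S → ℤ => ∑ s, x s ^ 2) (integralBases p) m :=
  fun _ hx => WithBot.coe_le_coe.mp (hπ.trans (dualObjective_le hx π))

theorem IsSeparatingChain.exists_sum_sq_le_dualObjective {C : ℤ → Finset S}
    (hC : IsSeparatingChain p m C) (hm : m ∈ integralBases p) :
    ∃ π, ((∑ s, m s ^ 2 : ℤ) : WithBot ℤ) ≤ dualObjective p π := by
  classical
  let π : S → ℤ := fun s => if s ∈ C (m s) then 2 * m s + 1 else 2 * m s - 1
  have hlevel (β : ℤ) : Finset.univ.filter (2 * β + 1 ≤ π ·) = C β := by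
    ext u
    have hlt := @hC.mem_of_lt β u
    have hle := @hC.le_of_mem β u
    grind
  refine ⟨π, (sum_sq_le_dualObjective_iff hm π).mpr ⟨?_, ?_⟩⟩
  · refine mem_halfBox_iff.mpr fun s => abs_le.mpr ?_
    grind
  · refine linearExtension_eq_of_tight (mem_integralBases.mp hm).1 fun s => ?_
    obtain ⟨β, hβ⟩ : ∃ β, π s = 2 * β + 1 := by
      by_cases hs : s ∈ C (m s)
      · exact ⟨m s, if_pos hs⟩
      · exact ⟨m s - 1, by grind⟩
    rw [hβ, hlevel]
    exact hC.tight β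

end Duality

section Characterization

variable {S : Type*} [Fintype S] [DecidableEq S] [Nonempty S] {p : Finset S → WithBot ℤ} {m : S → ℤ}

theorem mem_decMinElements_tfae (hp : Supermodular p) (h0 : p ∅ = 0) (hm : m ∈ integralBases p) :
    List.TFAE [m ∈ decMinElements (integralBases p),
      NoTightening p m,
      ∃ C, IsSeparatingChain p m C,
      ∃ π, ((∑ s, m s ^ 2 : ℤ) : WithBot ℤ) ≤ dualObjective p π,
      IsMinOn (fun x : S → ℤ => ∑ s, x s ^ 2) (integralBases p) m] := by
  tfae_have 1 → 2 := noTightening_of_mem_decMinElements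
  tfae_have 2 → 3 := fun h => h.exists_isSeparatingChain hp h0 hm
  tfae_have 3 → 1 := fun ⟨_, hC⟩ => hC.mem_decMinElements hm
  tfae_have 3 → 4 := fun ⟨_, hC⟩ => hC.exists_sum_sq_le_dualObjective hm
  tfae_have 4 → 5 := fun ⟨_, hπ⟩ => isMinOn_sum_sq_of_le_dualObjective hπ
  tfae_have 5 → 2 := noTightening_of_isMinOn_sum_sq
  tfae_finish

theorem IsDualOptimal.sum_sq_le_dualObjective_iff {π : S → ℤ} (hπ : IsDualOptimal p π)
    (hp : Supermodular p) (h0 : p ∅ = 0) (hm : m ∈ integralBases p) :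
    ((∑ s, m s ^ 2 : ℤ) : WithBot ℤ) ≤ dualObjective p π ↔
      m ∈ decMinElements (integralBases p) := by
  have htfae := mem_decMinElements_tfae hp h0 hm
  refine ⟨fun h => (htfae.out 3 0).mp (Exists.intro π h), fun h => ?_⟩
  obtain ⟨τ, hτ⟩ := (htfae.out 0 3).mp h
  exact hτ.trans (hπ τ)

theorem IsDualOptimal.linearExtension_eq_iff {π : S → ℤ} (hπ : IsDualOptimal p π)
    (hp : Supermodular p) (h0 : p ∅ = 0) (hm : m ∈ integralBases p) :
    linearExtension p π = ((∑ s, π s * m s : ℤ) : WithBot ℤ) ↔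
      m ∈ minWeightElements (integralBases p) π := by
  constructor
  · intro h
    refine ⟨hm, fun z hz => WithBot.coe_le_coe.mp ?_⟩
    exact h.symm.trans_le (linearExtension_le hz π)
  · rintro ⟨-, hmin⟩
    obtain ⟨m₀, hm₀, hm₀min⟩ := exists_isMinOn_sum_sq ⟨m, hm⟩
    have hdec := ((mem_decMinElements_tfae hp h0 hm₀).out 4 0).mp hm₀min
    have hlin := ((DecMin.sum_sq_le_dualObjective_iff hm₀ π).mp
      ((hπ.sum_sq_le_dualObjective_iff hp h0 hm₀).mpr hdec)).2
    refine (linearExtension_le hm π).antisymm (hlin ▸ ?_)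
    exact WithBot.coe_le_coe.mpr (hmin m₀ hm₀)

theorem decMinElements_eq_halfBox_inter_minWeightElements (hp : Supermodular p) (h0 : p ∅ = 0)
    {π : S → ℤ} (hπ : IsDualOptimal p π) :
    decMinElements (integralBases p) = halfBox π ∩ minWeightElements (integralBases p) π := by
  ext m
  constructor
  · intro hdec
    have hm : m ∈ integralBases p := hdec.1
    rwa [← hπ.sum_sq_le_dualObjective_iff hp h0 hm, sum_sq_le_dualObjective_iff hm,
      hπ.linearExtension_eq_iff hp h0 hm] at hdec
  · intro hmem
    have hm : m ∈ integralBases p := hmem.2.1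
    rwa [← hπ.sum_sq_le_dualObjective_iff hp h0 hm, sum_sq_le_dualObjective_iff hm,
      hπ.linearExtension_eq_iff hp h0 hm]

end Characterization

section MatroidBases

theorem indep_iff_forall_encard_inter_le {α : Type*} {M : Matroid α} [M.RankFinite] {X : Set α} :
    M.Indep X ↔ ∀ Z : Set α, (Z ∩ X).encard ≤ M.eRk Z := by
  refine ⟨fun hX Z => ?_, fun h => ?_⟩
  · exact (hX.subset Set.inter_subset_right).encard_le_eRk_of_subset Set.inter_subset_left
  · exact (M.isRkFinite_set X).indep_of_encard_le_eRk (by simpa only [Set.inter_self] using h X)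

theorem isBase_iff_encard_eq_eRank_and_indep {α : Type*} {M : Matroid α} [M.RankFinite]
    {X : Set α} : M.IsBase X ↔ X.encard = M.eRank ∧ M.Indep X := by
  refine ⟨fun hX => ⟨hX.encard_eq_eRank, hX.indep⟩, fun ⟨hcard, hX⟩ => ?_⟩
  exact hX.isBase_of_eRk_ge hX.finite (hcard.symm.trans hX.eRk_eq_encard.symm).le

variable {S : Type*}

theorem sum_indicator_one (X : Set S) (Z : Finset S) :
    ∑ s ∈ Z, X.indicator (1 : S → ℤ) s = ((Z : Set S) ∩ X).ncard := by
  classical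
  simp only [Set.indicator_apply, Pi.one_apply, Finset.sum_boole]
  rw [← Set.ncard_coe_finset, Finset.coe_filter]
  rfl

theorem exists_indicator_one_eq {x : S → ℤ} (hx : x ∈ Set.Icc 0 1) :
    ∃ X : Set S, X.indicator 1 = x := by
  refine ⟨{s | x s = 1}, funext fun s => ?_⟩
  have h0 := hx.1 s
  have h1 := hx.2 s
  simp only [Set.indicator_apply, Set.mem_ofPred_eq, Pi.zero_apply, Pi.one_apply] at *
  grind

section Fintype

variable [Fintype S] {M : Matroid S} {x : S → ℤ}

theorem mem_integralMembers_matroidBasePolyhedron :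
    x ∈ integralMembers (matroidBasePolyhedron M) ↔
      ∑ s, x s = (M.eRk Set.univ).toNat ∧ ∀ Z : Finset S, ∑ s ∈ Z, x s ≤ (M.eRk Z).toNat := by
  simp only [integralMembers, matroidBasePolyhedron, Set.mem_ofPred_eq]
  norm_cast

theorem indicator_one_mem_integralMembers_matroidBasePolyhedron {X : Set S} :
    X.indicator 1 ∈ integralMembers (matroidBasePolyhedron M) ↔ M.IsBase X := by
  have hle (Y Z : Set S) : Y.encard ≤ M.eRk Z ↔ (Y.ncard : ℤ) ≤ (M.eRk Z).toNat := by
    rw [← Y.toFinite.cast_ncard_eq, ← ENat.natCast_toNat (M.isRkFinite_set Z).eRk_lt_top.ne]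
    norm_cast
  have heq (Y Z : Set S) : Y.encard = M.eRk Z ↔ (Y.ncard : ℤ) = (M.eRk Z).toNat := by
    rw [← Y.toFinite.cast_ncard_eq, ← ENat.natCast_toNat (M.isRkFinite_set Z).eRk_lt_top.ne]
    norm_cast
  rw [mem_integralMembers_matroidBasePolyhedron, isBase_iff_encard_eq_eRank_and_indep,
    indep_iff_forall_encard_inter_le, ← M.eRk_univ_eq]
  simp only [sum_indicator_one, Finset.coe_univ, Set.univ_inter, hle, heq]
  refine and_congr_right fun _ => ⟨fun h Z => ?_, fun h Z => h Z⟩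
  simpa only [Set.Finite.coe_toFinset] using h Z.toFinite.toFinset

theorem mem_Icc_of_mem_integralMembers_matroidBasePolyhedron
    (hx : x ∈ integralMembers (matroidBasePolyhedron M)) : x ∈ Set.Icc 0 1 := by
  classical
  obtain ⟨huniv, hle⟩ := mem_integralMembers_matroidBasePolyhedron.mp hx
  refine ⟨fun s => ?_, fun s => ?_⟩
  · have hmono : (M.eRk (Finset.univ.erase s : Finset S)).toNat ≤ (M.eRk Set.univ).toNat :=
      ENat.toNat_le_toNat (M.eRk_mono (Set.subset_univ _)) (M.isRkFinite_set _).eRk_lt_top.ne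
    have hsum := Finset.add_sum_erase Finset.univ x (Finset.mem_univ s)
    have := hle (Finset.univ.erase s)
    simp only [Pi.zero_apply]
    lia
  · have hone : (M.eRk {s}).toNat ≤ 1 := ENat.toNat_le_of_le_natCast (M.eRk_singleton_le s)
    have := hle {s}
    simp only [Finset.sum_singleton, Finset.coe_singleton, Pi.one_apply] at this ⊢
    lia

theorem mem_integralMembers_matroidBasePolyhedron_iff_exists_isBase :
    x ∈ integralMembers (matroidBasePolyhedron M) ↔ ∃ X, M.IsBase X ∧ X.indicator 1 = x := by
  refine ⟨fun hx => ?_, ?_⟩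
  · obtain ⟨X, rfl⟩ :=
      exists_indicator_one_eq (mem_Icc_of_mem_integralMembers_matroidBasePolyhedron hx)
    exact ⟨X, indicator_one_mem_integralMembers_matroidBasePolyhedron.mp hx, rfl⟩
  · rintro ⟨X, hX, rfl⟩
    exact indicator_one_mem_integralMembers_matroidBasePolyhedron.mpr hX

end Fintype

theorem mem_integralMembers_translate {P : Set (S → ℝ)} {Δ m : S → ℤ} :
    m ∈ integralMembers ((fun x s => x s + (Δ s : ℝ)) '' P) ↔ m - Δ ∈ integralMembers P := by
  have hinv : Function.LeftInverse (fun (x : S → ℝ) s => x s - (Δ s : ℝ))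
      fun x s => x s + (Δ s : ℝ) := fun x => by simp
  rw [integralMembers, Set.mem_ofPred_eq, Set.mem_image_iff_of_inverse hinv fun x => by simp]
  simp [integralMembers]

variable [DecidableEq S]

theorem shift_add_indicator_one (Δ : S → ℤ) {X : Set S} {s t : S} (hs : s ∉ X) (ht : t ∈ X) :
    shift (Δ + X.indicator 1) s t = Δ + (insert s (X \ {t})).indicator 1 := by
  classical
  ext u
  simp only [shift, Pi.sub_apply, Pi.add_apply, Pi.single_apply, Set.indicator_apply,
    Set.mem_insert_iff, Set.mem_sdiff, Set.mem_singleton_iff, Pi.one_apply]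
  grind

theorem IsMConvex.exists_matroid [Finite S] {D : Set (S → ℤ)} (hD : IsMConvex D) {Δ : S → ℤ}
    (hne : ∃ X : Set S, Δ + X.indicator 1 ∈ D) :
    ∃ M : Matroid S, M.E = Set.univ ∧ ∀ X, M.IsBase X ↔ Δ + X.indicator 1 ∈ D := by
  refine ⟨Matroid.ofIsBaseOfFinite Set.finite_univ (fun X => Δ + X.indicator 1 ∈ D) hne ?_
    fun _ _ => Set.subset_univ _, rfl, fun _ => Iff.rfl⟩
  rintro X Y hX hY t ⟨htX, htY⟩
  obtain ⟨s, hs, hshift, -⟩ := hD _ hX _ hY t (by simp [htX, htY])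
  obtain ⟨hsX, hsY⟩ : s ∉ X ∧ s ∈ Y := by
    classical
    simp only [Pi.add_apply, add_lt_add_iff_left, Set.indicator_apply, Pi.one_apply] at hs
    grind
  rw [shift_add_indicator_one Δ hsX htX] at hshift
  exact ⟨s, ⟨hsY, hsX⟩, hshift⟩

variable [Fintype S]

theorem IsMConvex.isMatroidalMConvex {D : Set (S → ℤ)} (hD : IsMConvex D) (hne : D.Nonempty)
    {Δ : S → ℤ} (hbox : D ⊆ Set.Icc Δ (Δ + 1)) : IsMatroidalMConvex D := by
  have hind {m : S → ℤ} (hm : m ∈ D) : ∃ X : Set S, X.indicator 1 = m - Δ :=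
    exists_indicator_one_eq ⟨sub_nonneg.mpr (hbox hm).1, sub_le_iff_le_add'.mpr (hbox hm).2⟩
  obtain ⟨M, hME, hM⟩ := hD.exists_matroid (Δ := Δ) <| by
    obtain ⟨m, hm⟩ := hne
    obtain ⟨X, hX⟩ := hind hm
    exact ⟨X, by simpa [hX] using hm⟩
  refine ⟨M, Δ, hME, Set.ext fun m => ?_⟩
  rw [mem_integralMembers_translate, mem_integralMembers_matroidBasePolyhedron_iff_exists_isBase]
  constructor
  · intro hm
    obtain ⟨X, hX⟩ := hind hm
    exact ⟨X, (hM X).mpr (by simpa [hX] using hm), hX⟩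
  · rintro ⟨X, hX, hXm⟩
    simpa [hXm] using (hM X).mp hX

end MatroidBases

section DecMinMatroid

variable {S : Type*} [Fintype S] [DecidableEq S] [Nonempty S] {p : Finset S → WithBot ℤ}

theorem decMinElements_eq_setOf_isMinOn_sum_sq (hp : Supermodular p) (h0 : p ∅ = 0) :
    decMinElements (integralBases p) =
      {m ∈ integralBases p | IsMinOn (fun x : S → ℤ => ∑ s, x s ^ 2) (integralBases p) m} :=
  Set.ext fun m => ⟨fun h => ⟨h.1, ((mem_decMinElements_tfae hp h0 h.1).out 0 4).mp h⟩,
    fun h => ((mem_decMinElements_tfae hp h0 h.1).out 0 4).mpr h.2⟩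

theorem isMConvex_decMinElements (hp : Supermodular p) (h0 : p ∅ = 0) :
    IsMConvex (decMinElements (integralBases p)) := by
  rw [decMinElements_eq_setOf_isMinOn_sum_sq hp h0]
  refine (isMConvex_integralBases hp h0).setOf_isMinOn_sum (φ := fun _ k => k ^ 2)
    fun _ j k hjk => ?_
  linarith

theorem exists_isDualOptimal (hp : Supermodular p) (h0 : p ∅ = 0) {m : S → ℤ}
    (hm : m ∈ decMinElements (integralBases p)) : ∃ π, IsDualOptimal p π := by
  obtain ⟨π, hπ⟩ := ((mem_decMinElements_tfae hp h0 hm.1).out 0 3).mp hm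
  exact ⟨π, fun τ => (dualObjective_le hm.1 τ).trans hπ⟩

theorem isMatroidalMConvex_decMinElements (hp : Supermodular p) (h0 : p ∅ = 0)
    (huniv : p Finset.univ ≠ ⊥) : IsMatroidalMConvex (decMinElements (integralBases p)) := by
  obtain ⟨m, hm, hmin⟩ := exists_isMinOn_sum_sq (integralBases_nonempty hp h0 huniv)
  have hdec := ((mem_decMinElements_tfae hp h0 hm).out 4 0).mp hmin
  obtain ⟨π, hπ⟩ := exists_isDualOptimal hp h0 hdec
  refine (isMConvex_decMinElements hp h0).isMatroidalMConvex ⟨m, hdec⟩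
    (Set.Subset.trans ?_ (halfBox_subset_Icc π))
  rw [decMinElements_eq_halfBox_inter_minWeightElements hp h0 hπ]
  exact Set.inter_subset_left

end DecMinMatroid

end DecMin

theorem mainTheorem9 {S : Type*} [Fintype S] [DecidableEq S] [Nonempty S]
    (p : Finset S → WithBot ℤ) (hp_empty : p ∅ = 0) (hp_univ : p Finset.univ ≠ ⊥)
    (hp : DecMin.Supermodular p) :
    (∀ π : S → ℤ, DecMin.IsDualOptimal p π →
      DecMin.decMinElements (DecMin.integralMembers (DecMin.basePolyhedron p)) =
        DecMin.halfBox π ∩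
          DecMin.minWeightElements (DecMin.integralMembers (DecMin.basePolyhedron p)) π) ∧
    DecMin.IsMatroidalMConvex
      (DecMin.decMinElements (DecMin.integralMembers (DecMin.basePolyhedron p))) :=
  ⟨fun _ hπ => DecMin.decMinElements_eq_halfBox_inter_minWeightElements hp hp_empty hπ,
    DecMin.isMatroidalMConvex_decMinElements hp hp_empty hp_univ⟩
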